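/- Let $R=\bigoplus_{d\ge 0}R_d$ be a commutative $\mathbb{N}$-graded ring that is a finitely generated graded algebra over a Noetherian commutative ring $A$ (so $A$ maps into $R_0$). Suppose that $R$ has a maximal graded ideal $\mathfrak{m}$, that is, a greatest proper homogeneous ideal, and that $R/\mathfrak{m}$ is an infinite field. A graded filtration of $R$ is a family $\mathcal{I}=\{I_{[k]}\}_{k\ge 0}$ of homogeneous ideals with $I_{[0]}=R$, $I_{[k+1]}\subseteq I_{[k]}$ and $I_{[k]}I_{[\ell]}\subseteq I_{[k+\ell]}$ for all $k,\ell\ge 0$; it is Noetherian if its Rees algebra $\bigoplus_{k\ge 0}I_{[k]}$ is a Noetherian ring. For a proper homogeneous ideal $I\subset R$ and $\mathfrak{p}\in\operatorname{Ass}(R/I)$, let $\mathrm{v}_{\mathfrak{p}}(I)$ be the least degree of a homogeneous $f\in R$ with $(I:f)=\mathfrak{p}$, and let $\mathrm{v}(I)=\min_{\mathfrak{p}\in\operatorname{Ass}(R/I)}\mathrm{v}_{\mathfrak{p}}(I)$. Theorem. Let $\mathcal{I}=\{I_{[k]}\}_{k\ge 0}$ be a Noetherian graded filtration of $R$ with $I_{[k]}\ne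 R$ for some $k$. Then $\mathrm{v}(I_{[k]})$ is an eventually quasi-linear function of $k$: there exist an integer $c>0$ and $a_0,\dots,a_{c-1},b_0,\dots,b_{c-1}\in\mathbb{Q}$ such that, for all sufficiently large $k$, $\mathrm{v}(I_{[k]})$ is a (finite) non-negative integer and $\mathrm{v}(I_{[k]})=a_ik+b_i$ whenever $k\equiv i \pmod c$, $0\le i\le c-1$. -/

import Mathlib

open Filter
open scoped Polynomial

section VNumber

variable {A R : Type*} [CommRing A] [CommRing R] [Algebra A R]

/-- `m` is the maximal graded ideal of `R`: the greatest proper homogeneous ideal. -/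
def IsMaximalGradedIdeal (𝒜 : ℕ → Submodule A R) [GradedAlgebra 𝒜] (m : Ideal R) : Prop :=
  IsGreatest {J : Ideal R | J.IsHomogeneous 𝒜 ∧ J ≠ ⊤} m

/-- The `v`-number of `I` at `p`: the least degree `d` of a homogeneous element `f` such that
`(I : f) = p`. It takes values in `ℕ∞`, and it is `⊤` if there is no such element. -/
noncomputable def vNumberAt (𝒜 : ℕ → Submodule A R) (I p : Ideal R) : ℕ∞ :=
  ⨅ (d : ℕ) (_ : ∃ f ∈ 𝒜 d, I.colon {f} = p), (d : ℕ∞)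

/-- The `v`-number of `I`: the minimum of the `v`-numbers of `I` at the associated primes of `I`,
that is, of the module `R ⧸ I`. It is `⊤` if `I` has no associated prime (`I = R`). -/
noncomputable def vNumber (𝒜 : ℕ → Submodule A R) (I : Ideal R) : ℕ∞ :=
  ⨅ p ∈ associatedPrimes R (R ⧸ I), vNumberAt 𝒜 I p

/-- A graded filtration of the graded ring `R`. -/
structure GradedFiltration (𝒜 : ℕ → Submodule A R) [GradedAlgebra 𝒜] where
  /-- The `k`-th ideal of the filtration. -/
  ideal : ℕ → Ideal R
  isHomogeneous : ∀ k, (ideal k).IsHomogeneous 𝒜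
  ideal_zero : ideal 0 = ⊤
  ideal_succ_le : ∀ k, ideal (k + 1) ≤ ideal k
  ideal_mul_le : ∀ k l, ideal k * ideal l ≤ ideal (k + l)

namespace GradedFiltration

variable {𝒜 : ℕ → Submodule A R} [GradedAlgebra 𝒜]

/-- The Rees algebra `⨁ₖ I_[k]` of a graded filtration, realized as the subalgebra
`⨁ₖ I_[k] Xᵏ` of `R[X]`. -/
def reesAlgebra (F : GradedFiltration 𝒜) : Subalgebra R R[X] where
  carrier := {f | ∀ k, f.coeff k ∈ F.ideal k}
  mul_mem' {f g} hf hg k := by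
    rw [Polynomial.coeff_mul]
    refine Ideal.sum_mem _ fun x hx => ?_
    rw [← Finset.HasAntidiagonal.mem_antidiagonal.mp hx]
    exact F.ideal_mul_le _ _ (Ideal.mul_mem_mul (hf x.1) (hg x.2))
  add_mem' {f g} hf hg k := by
    rw [Polynomial.coeff_add]
    exact Ideal.add_mem _ (hf k) (hg k)
  algebraMap_mem' r k := by
    rw [Polynomial.algebraMap_apply, Polynomial.coeff_C]
    split_ifs with h
    · subst h
      simp [F.ideal_zero]
    · exact Ideal.zero_mem _

/-- A graded filtration is Noetherian if its Rees algebra is a Noetherian ring. -/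
def IsNoetherian (F : GradedFiltration 𝒜) : Prop :=
  IsNoetherianRing F.reesAlgebra

end GradedFiltration

end VNumber

/-- `f` is eventually finite and quasi-linear: there are a period `c > 0` and linear functions
`a i * k + b i` with rational coefficients, one for each residue class `i` modulo `c`, such that
`f k = a i * k + b i` for all `k ≫ 0`, where `i = k % c`. -/
def IsEventuallyQuasiLinear (f : ℕ → ℕ∞) : Prop :=
  ∃ c : ℕ, 0 < c ∧ ∃ a b : ℕ → ℚ, ∀ᶠ k in atTop,
    ∃ n : ℕ, f k = (n : ℕ∞) ∧ (n : ℚ) = a (k % c) * (k : ℚ) + b (k % c)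

/-! Fix a prime `p`. Then `(I_[k] : f) = p` means that `p f ⊆ I_[k]` and that `f` lies outside the
contraction of `I_[k] R_p`. With `x` generating `p`, the vectors `(x i * f) X^k` span a submodule of
a finite free module over the Noetherian Rees algebra, so finitely many `g` generate all such `f`
modulo the annihilator of `p` (`exists_colon_generators`). Expanding the coefficients in monomials
of generators `s i`, it suffices to test elements of that annihilator, which contribute an antitone
sequence, and products `s^a * g.2`. The admissible exponents `a` form a lower set, and minimizing a
linear form over its slices of given weight is quasi-affine (`IsLowerSet.quasiAffine_minWeight`).

Only finitely many primes occur for large `k` (`exists_finite_primes`): those outside `Ass R` are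
contracted from associated primes of one finite module over the Rees algebra. A finite minimum of
quasi-affine sequences is quasi-affine. -/

/-! ### Eventually affine sequences in `ℕ∞` -/

/-- `g` eventually satisfies `g (j + 1) = g j + e`; the value `⊤` is allowed. -/
def EventuallyAffine (g : ℕ → ℕ∞) : Prop :=
  ∃ e : ℕ, ∀ᶠ j in atTop, g (j + 1) = g j + e

/-- `f` is eventually affine (or `⊤`) along each residue class modulo some `c > 0`. -/
def QuasiAffine (f : ℕ → ℕ∞) : Prop :=
  ∃ c : ℕ, 0 < c ∧ ∀ i, EventuallyAffine fun j => f (i + c * j)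

theorem eq_add_mul_of_forall_succ {g : ℕ → ℕ∞} {e K : ℕ}
    (h : ∀ j ≥ K, g (j + 1) = g j + e) (j : ℕ) : g (K + j) = g K + (j * e : ℕ) := by
  induction j with
  | zero => simp
  | succ j ih =>
    rw [← add_assoc, h _ (by omega), ih, add_assoc]
    congr 1
    push_cast
    ring

theorem EventuallyAffine.congr {g h : ℕ → ℕ∞} (hg : EventuallyAffine g)
    (hgh : ∀ᶠ j in atTop, h j = g j) : EventuallyAffine h := by
  obtain ⟨e, he⟩ := hg
  refine ⟨e, ?_⟩
  filter_upwards [he, hgh, (tendsto_add_atTop_nat 1).eventually hgh] with j h1 h2 h3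
  rw [h2, h3, h1]

theorem EventuallyAffine.comp_mul {g : ℕ → ℕ∞} (hg : EventuallyAffine g) {m : ℕ} (hm : 0 < m) :
    EventuallyAffine fun j => g (m * j) := by
  obtain ⟨e, he⟩ := hg
  obtain ⟨K, hK⟩ := eventually_atTop.mp he
  refine ⟨m * e, eventually_atTop.mpr ⟨K, fun j hj => ?_⟩⟩
  have hj' : K ≤ m * j := hj.trans (Nat.le_mul_of_pos_left j hm)
  have := eq_add_mul_of_forall_succ (g := g) (e := e) (K := m * j)
    (fun i hi => hK i (hj'.trans hi)) m
  simpa [mul_add] using this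

theorem EventuallyAffine.min {g h : ℕ → ℕ∞} (hg : EventuallyAffine g) (hh : EventuallyAffine h) :
    EventuallyAffine fun j => g j ⊓ h j := by
  have key : ∀ {g h : ℕ → ℕ∞} {e₁ e₂ : ℕ}, e₁ ≤ e₂ → (∀ᶠ j in atTop, g (j + 1) = g j + e₁) →
      (∀ᶠ j in atTop, h (j + 1) = h j + e₂) → EventuallyAffine fun j => g j ⊓ h j := by
    intro g h e₁ e₂ he h1 h2
    rcases he.eq_or_lt with rfl | hlt
    · refine ⟨e₁, ?_⟩
      filter_upwards [h1, h2] with j h1 h2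
      rw [h1, h2, min_add_add_right]
    · obtain ⟨K, hK⟩ := eventually_atTop.mp (h1.and h2)
      have hg := eq_add_mul_of_forall_succ (fun j hj => (hK j hj).1)
      have hh := eq_add_mul_of_forall_succ (fun j hj => (hK j hj).2)
      by_cases htop : g K = ⊤
      · refine EventuallyAffine.congr ⟨e₂, h2⟩ (eventually_atTop.mpr ⟨K, fun j hj => ?_⟩)
        obtain ⟨t, rfl⟩ := Nat.exists_eq_add_of_le hj
        simp [hg t, htop]
      · obtain ⟨n, hn⟩ := ENat.ne_top_iff_exists.mp htop
        -- Here `n = g K`: the slopes differ by at least one, so after `n` steps the smaller slope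
        -- has won.
        refine EventuallyAffine.congr ⟨e₁, h1⟩ (eventually_atTop.mpr ⟨K + n, fun j hj => ?_⟩)
        obtain ⟨t, rfl⟩ := Nat.exists_eq_add_of_le (show K ≤ j by omega)
        refine inf_eq_left.mpr ?_
        rw [hg, hh, ← hn]
        refine le_trans ?_ le_add_self
        norm_cast
        have ht : n ≤ t := by omega
        nlinarith
  obtain ⟨e₁, h1⟩ := hg
  obtain ⟨e₂, h2⟩ := hh
  rcases le_total e₁ e₂ with he | he
  · exact key he h1 h2
  · simpa only [inf_comm] using key he h2 h1

theorem QuasiAffine.mul_period {f : ℕ → ℕ∞} {c m : ℕ} (hm : 0 < m)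
    (h : ∀ i, EventuallyAffine fun j => f (i + c * j)) (i : ℕ) :
    EventuallyAffine fun j => f (i + c * m * j) := by
  simpa only [mul_assoc] using (h i).comp_mul hm

theorem QuasiAffine.min {f g : ℕ → ℕ∞} (hf : QuasiAffine f) (hg : QuasiAffine g) :
    QuasiAffine fun k => f k ⊓ g k := by
  obtain ⟨c, hc, hf⟩ := hf
  obtain ⟨c', hc', hg⟩ := hg
  refine ⟨c * c', Nat.mul_pos hc hc', fun i => (mul_period hc' hf i).min ?_⟩
  simpa only [mul_comm] using mul_period hc hg i

theorem QuasiAffine.of_eventually {f : ℕ → ℕ∞} {c e : ℕ} (hc : 0 < c)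
    (h : ∀ᶠ k in atTop, f (k + c) = f k + e) : QuasiAffine f := by
  refine ⟨c, hc, fun i => ⟨e, ?_⟩⟩
  obtain ⟨K, hK⟩ := eventually_atTop.mp h
  refine eventually_atTop.mpr ⟨K, fun j hj => ?_⟩
  dsimp only
  rw [mul_add, mul_one, ← add_assoc]
  exact hK _ (le_add_left (hj.trans (Nat.le_mul_of_pos_left j hc)))

theorem QuasiAffine.of_eventually_const {f : ℕ → ℕ∞} {n : ℕ∞} (h : ∀ᶠ k in atTop, f k = n) :
    QuasiAffine f := by
  refine .of_eventually (c := 1) (e := 0) one_pos ?_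
  filter_upwards [h, (tendsto_add_atTop_nat 1).eventually h] with k h1 h2
  simp [h1, h2]

theorem QuasiAffine.of_antitone {f : ℕ → ℕ∞} (hf : Antitone f) : QuasiAffine f := by
  obtain ⟨n, hn⟩ := WellFoundedGT.monotone_chain_condition (α := ℕ∞ᵒᵈ)
    ⟨fun k => OrderDual.toDual (f k), fun _ _ h => hf h⟩
  exact .of_eventually_const (eventually_atTop.mpr ⟨n, fun k hk => (hn k hk).symm⟩)

theorem QuasiAffine.iInf_finset {α : Type*} (s : Finset α) {f : α → ℕ → ℕ∞}
    (h : ∀ a ∈ s, QuasiAffine (f a)) : QuasiAffine fun k => ⨅ a ∈ s, f a k := by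
  classical
  induction s using Finset.induction with
  | empty => exact .of_eventually_const (n := ⊤) (by simp)
  | insert a s _ ih =>
    simp only [Finset.iInf_insert]
    exact (h a (by simp)).min (ih fun b hb => h b (by simp [hb]))

theorem QuasiAffine.isEventuallyQuasiLinear {f : ℕ → ℕ∞} (hf : QuasiAffine f)
    (hfin : ∀ᶠ k in atTop, f k ≠ ⊤) : IsEventuallyQuasiLinear f := by
  obtain ⟨c, hc, hf⟩ := hf
  choose e he using hf
  obtain ⟨K₀, hK₀⟩ := eventually_atTop.mp hfin
  have : ∀ i, ∃ K ≥ K₀, ∀ j ≥ K, f (i + c * (j + 1)) = f (i + c * j) + e i := fun i => by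
    obtain ⟨K, hK⟩ := eventually_atTop.mp (he i)
    exact ⟨max K K₀, le_max_right _ _, fun j hj => hK j ((le_max_left _ _).trans hj)⟩
  choose K hK hstep using this
  have hval : ∀ i, ∃ n : ℕ, (n : ℕ∞) = f (i + c * K i) := fun i =>
    ENat.ne_top_iff_exists.mp (hK₀ _ (le_add_left ((hK i).trans (Nat.le_mul_of_pos_left _ hc))))
  choose n hn using hval
  -- The coefficients come from solving `k = i + c * (K i + t)` for `t` in `n i + t * e i`.
  refine ⟨c, hc, fun i => e i / c, fun i => n i - K i * e i - i * e i / c, ?_⟩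
  refine eventually_atTop.mpr ⟨c * ((Finset.range c).sup K + 1), fun k hk => ?_⟩
  set i := k % c with hi
  have hic : i < c := Nat.mod_lt _ hc
  have hkdiv : i + c * (k / c) = k := Nat.mod_add_div k c
  have hKi : K i ≤ k / c := by
    have h1 : K i ≤ (Finset.range c).sup K := Finset.le_sup (Finset.mem_range.mpr hic)
    have h2 := (Nat.le_div_iff_mul_le hc).mpr (show ((Finset.range c).sup K + 1) * c ≤ k by
      rwa [mul_comm])
    omega
  obtain ⟨t, ht⟩ := Nat.exists_eq_add_of_le hKi
  have hf := eq_add_mul_of_forall_succ (g := fun j => f (i + c * j)) (hstep i) t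
  simp only [← ht, hkdiv, ← hn i] at hf
  refine ⟨n i + t * e i, by rw [hf]; norm_cast, ?_⟩
  have hkq : (k : ℚ) = i + c * (K i + t) := by
    rw [← hkdiv, ht]; push_cast; rfl
  have : (c : ℚ) ≠ 0 := by positivity
  rw [hkq]
  push_cast
  field_simp
  ring

/-! ### Minimal weights and linear forms on lower sets -/

/-- The least value of `w` on `s`, or `⊤` if `s` is empty. -/
noncomputable def minWeight {α : Type*} (s : Set α) (w : α → ℕ) : ℕ∞ :=
  ⨅ a ∈ s, (w a : ℕ∞)

section MinWeight

variable {α : Type*} {s t : Set α} {w : α → ℕ} {e : ℕ}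

theorem minWeight_le {a : α} (ha : a ∈ s) : minWeight s w ≤ w a :=
  iInf₂_le a ha

theorem minWeight_empty : minWeight (∅ : Set α) w = ⊤ := by
  simp [minWeight]

theorem exists_minWeight_eq (hs : s.Nonempty) : ∃ a ∈ s, minWeight s w = w a := by
  refine ⟨Function.argminOn w s hs, Function.argminOn_mem w s hs, ?_⟩
  refine le_antisymm (minWeight_le (Function.argminOn_mem w s hs)) (le_iInf₂ fun a ha => ?_)
  exact_mod_cast Function.argminOn_le w s ha

theorem minWeight_le_add (h : ∀ a ∈ s, ∃ b ∈ t, w b ≤ w a + e) :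
    minWeight t w ≤ minWeight s w + e := by
  rcases s.eq_empty_or_nonempty with rfl | hs
  · simp [minWeight_empty]
  · obtain ⟨a, ha, hw⟩ := exists_minWeight_eq (w := w) hs
    obtain ⟨b, hb, hba⟩ := h a ha
    rw [hw]
    exact (minWeight_le hb).trans (by exact_mod_cast hba)

theorem minWeight_add_le (h : ∀ b ∈ t, ∃ a ∈ s, w a + e ≤ w b) :
    minWeight s w + e ≤ minWeight t w := by
  refine le_iInf₂ fun b hb => ?_
  obtain ⟨a, ha, hab⟩ := h b hb
  exact (add_le_add_left (minWeight_le ha) _).trans (by exact_mod_cast hab)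

end MinWeight

theorem Pi.single_le_of_le {ι : Type*} [DecidableEq ι] {b : ι → ℕ} {i : ι} {c : ℕ} (h : c ≤ b i) :
    Pi.single i c ≤ b := fun j => by
  by_cases hj : j = i
  · subst hj; simpa
  · simp [hj]

section Lattice

variable {ι : Type*} [Fintype ι]

/-- The linear form on `ℕ^ι` with coefficients `κ`. -/
def linForm (κ a : ι → ℕ) : ℕ := ∑ i, κ i * a i

theorem linForm_add (κ a b : ι → ℕ) : linForm κ (a + b) = linForm κ a + linForm κ b := by
  simp [linForm, mul_add, Finset.sum_add_distrib]

theorem linForm_single [DecidableEq ι] (κ : ι → ℕ) (i : ι) (c : ℕ) :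
    linForm κ (Pi.single i c) = κ i * c := by
  simp [linForm, Pi.single_apply]

/-- The points `a ≥ a₀` that agree with `a₀` outside of `s`. -/
def orthant (s : Finset ι) (a₀ : ι → ℕ) : Set (ι → ℕ) :=
  {a | a₀ ≤ a ∧ ∀ i ∉ s, a i = a₀ i}

variable {κ : ι → ℕ}

/-- The free direction `p` of least ratio `δ / κ` is the cheapest way to gain weight, so for large
weights a step of `κ p` costs exactly `δ p`. -/
theorem quasiAffine_minWeight_orthant (hκ : ∀ i, 0 < κ i) (δ : ι → ℕ) (k₀ d₀ : ℕ)
    (s : Finset ι) (a₀ : ι → ℕ) :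
    QuasiAffine fun k =>
      minWeight {a | a ∈ orthant s a₀ ∧ k₀ + linForm κ a = k} fun a => d₀ + linForm δ a := by
  classical
  rcases s.eq_empty_or_nonempty with rfl | hs
  · refine .of_eventually_const (n := ⊤)
      (eventually_atTop.mpr ⟨k₀ + linForm κ a₀ + 1, fun k hk => ?_⟩)
    convert minWeight_empty
    refine Set.eq_empty_of_forall_notMem fun a ⟨⟨_, ha⟩, hk'⟩ => ?_
    obtain rfl : a = a₀ := funext fun i => ha i (by simp)
    omega
  obtain ⟨p, hp, hmin⟩ := s.exists_min_image (fun i => (δ i : ℚ) / κ i) hs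
  have hmin : ∀ i ∈ s, δ p * κ i ≤ δ i * κ p := fun i hi => by
    have h := hmin i hi
    have h1 : (0 : ℚ) < κ p := by exact_mod_cast hκ p
    have h2 : (0 : ℚ) < κ i := by exact_mod_cast hκ i
    rw [div_le_div_iff₀ h1 h2] at h
    exact_mod_cast h
  refine .of_eventually (hκ p) (e := δ p) (eventually_atTop.mpr
    ⟨k₀ + linForm κ (a₀ + fun _ => κ p), fun k hk => le_antisymm ?_ ?_⟩)
  · refine minWeight_le_add fun a ⟨⟨ha, has⟩, hak⟩ => ⟨a + Pi.single p 1, ⟨⟨?_, ?_⟩, ?_⟩, ?_⟩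
    · exact ha.trans le_self_add
    · intro i hi
      have : i ≠ p := fun h => hi (h ▸ hp)
      simp [this, has i hi]
    · rw [linForm_add, linForm_single, mul_one]; omega
    · rw [linForm_add, linForm_single, mul_one, add_assoc]
  · refine minWeight_add_le fun b ⟨⟨hb, hbs⟩, hbk⟩ => ?_
    by_cases hbp : a₀ p + 1 ≤ b p
    · have hb' : b - Pi.single p 1 + Pi.single p 1 = b :=
        tsub_add_cancel_of_le (Pi.single_le_of_le (by omega))
      have h1 := linForm_add κ (b - Pi.single p 1) (Pi.single p 1)
      have h2 := linForm_add δ (b - Pi.single p 1) (Pi.single p 1)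
      rw [hb', linForm_single, mul_one] at h1 h2
      refine ⟨b - Pi.single p 1, ⟨⟨fun i => ?_, fun i hi => ?_⟩, by omega⟩, by omega⟩
      · by_cases hip : i = p
        · subst hip; simp; omega
        · simpa [hip] using hb i
      · have : i ≠ p := fun h => hi (h ▸ hp)
        simp [this, hbs i hi]
    · have hbp' : b p = a₀ p := le_antisymm (by omega) (hb p)
      -- The lower bound on `k` was chosen to force such a large coordinate.
      obtain ⟨i, hi⟩ : ∃ i, a₀ i + κ p < b i := by
        by_contra! hcon
        have : linForm κ b ≤ linForm κ (a₀ + fun _ => κ p) :=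
          Finset.sum_le_sum fun i _ => Nat.mul_le_mul_left _ (hcon i)
        have := hκ p
        omega
      have his : i ∈ s := by
        by_contra his
        have := hbs i his
        omega
      have hip : i ≠ p := by
        rintro rfl
        omega
      -- Exchange `κ p` units at `i` for `κ i` units at `p`: same weight, no larger degree by
      -- `hmin`. Then drop one unit at `p`, which leaves `q = κ i - 1`.
      set b' := b - Pi.single i (κ p) with hb'
      have hbb : b' + Pi.single i (κ p) = b :=
        tsub_add_cancel_of_le (Pi.single_le_of_le (by omega))
      have h1 := linForm_add κ b' (Pi.single i (κ p))
      have h2 := linForm_add δ b' (Pi.single i (κ p))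
      rw [hbb, linForm_single] at h1 h2
      have h3 := linForm_add κ b' (Pi.single p (κ i - 1))
      have h4 := linForm_add δ b' (Pi.single p (κ i - 1))
      rw [linForm_single] at h3 h4
      have h5 := hmin i his
      obtain ⟨q, hq⟩ := Nat.exists_eq_succ_of_ne_zero (hκ i).ne'
      rw [hq, Nat.succ_sub_one] at h3 h4
      rw [hq, Nat.succ_eq_add_one, mul_add, mul_one] at h5
      rw [hq, Nat.succ_eq_add_one, add_mul, one_mul, mul_comm q] at h1
      refine ⟨b' + Pi.single p q, ⟨⟨fun j => ?_, fun j hj => ?_⟩, by omega⟩, by omega⟩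
      · by_cases hji : j = i
        · subst hji; simp [hb', hip]; omega
        · simpa [hb', hji] using (hb j).trans le_self_add
      · have hjp : j ≠ p := fun h => hj (h ▸ hp)
        have hji : j ≠ i := fun h => hj (h ▸ his)
        simp [hb', hjp, hji, hbs j hj]

/-- If the orthant contains some `b ∉ D`, each of its points in `D` has a free coordinate below that
of `b`. Freezing it at one of finitely many values leaves fewer free coordinates. -/
theorem quasiAffine_minWeight_inter_orthant (hκ : ∀ i, 0 < κ i) (δ : ι → ℕ) (k₀ d₀ : ℕ)
    {D : Set (ι → ℕ)} (hD : IsLowerSet D) (s : Finset ι) (a₀ : ι → ℕ) :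
    QuasiAffine fun k => minWeight {a | a ∈ D ∧ a ∈ orthant s a₀ ∧ k₀ + linForm κ a = k}
      fun a => d₀ + linForm δ a := by
  classical
  induction s using Finset.strongInduction generalizing a₀ with
  | H s ih =>
  by_cases hsub : orthant s a₀ ⊆ D
  · convert quasiAffine_minWeight_orthant hκ δ k₀ d₀ s a₀ using 5 with k a
    exact and_iff_right_of_imp fun h : a ∈ orthant s a₀ ∧ _ => hsub h.1
  obtain ⟨b, ⟨hb, hbs⟩, hbD⟩ := Set.not_subset.mp hsub
  have key := QuasiAffine.iInf_finset s fun i hi => QuasiAffine.iInf_finset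
    (Finset.Ico (a₀ i) (b i)) fun v _ =>
      ih (s.erase i) (Finset.erase_ssubset hi) (Function.update a₀ i v)
  convert key using 2 with k
  refine le_antisymm ?_ ?_
  · simp only [le_iInf_iff, minWeight]
    rintro i hi v hv a ⟨haD, ⟨ha, has⟩, hak⟩
    refine minWeight_le (w := fun a => d₀ + linForm δ a) ⟨haD, ⟨fun j => ?_, fun j hj => ?_⟩, hak⟩
    · have := ha j
      by_cases hji : j = i
      · subst hji
        simp only [Function.update_self] at this
        exact (Finset.mem_Ico.mp hv).1.trans this
      · simpa [hji] using this
    · have hji : j ≠ i := fun h => hj (h ▸ hi)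
      simpa [hji] using has j (fun h => hj (Finset.mem_of_mem_erase h))
  · refine le_iInf₂ fun a ⟨haD, ⟨ha, has⟩, hak⟩ => ?_
    obtain ⟨i, hi⟩ : ∃ i, a i < b i := by
      by_contra! hcon
      exact hbD (hD hcon haD)
    have his : i ∈ s := by
      by_contra his
      rw [has i his, hbs i his] at hi
      exact lt_irrefl _ hi
    refine (iInf₂_le i his).trans ((iInf₂_le (a i) (Finset.mem_Ico.mpr ⟨ha i, hi⟩)).trans ?_)
    refine minWeight_le (w := fun a => d₀ + linForm δ a) ⟨haD, ⟨fun j => ?_, fun j hj => ?_⟩, hak⟩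
    · by_cases hji : j = i
      · subst hji; simp
      · simpa [hji] using ha j
    · by_cases hji : j = i
      · subst hji; simp
      · simpa [hji] using has j fun h => hj (Finset.mem_erase.mpr ⟨hji, h⟩)

/-- The least value of an affine form with natural coefficients on the slices of a lower set
of `ℕ^ι` is quasi-affine. -/
theorem IsLowerSet.quasiAffine_minWeight (hκ : ∀ i, 0 < κ i) (δ : ι → ℕ) (k₀ d₀ : ℕ)
    {D : Set (ι → ℕ)} (hD : IsLowerSet D) :
    QuasiAffine fun k => minWeight {a | a ∈ D ∧ k₀ + linForm κ a = k}
      fun a => d₀ + linForm δ a := by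
  convert quasiAffine_minWeight_inter_orthant hκ δ k₀ d₀ hD Finset.univ 0 using 4 with k a
  simp [orthant]

end Lattice

/-! ### Finite generation over the Rees algebra -/

section Rees

variable {A R : Type*} [CommRing A] [CommRing R] [Algebra A R]
variable {𝒜 : ℕ → Submodule A R} [GradedAlgebra 𝒜]

namespace GradedFiltration

variable (F : GradedFiltration 𝒜)

theorem antitone_ideal : Antitone F.ideal :=
  antitone_nat_of_succ_le F.ideal_succ_le

variable {F}

theorem monomial_mem_reesAlgebra {k : ℕ} {f : R} (hf : f ∈ F.ideal k) :
    Polynomial.monomial k f ∈ F.reesAlgebra := fun l => by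
  rw [Polynomial.coeff_monomial]
  split_ifs with h
  · exact h ▸ hf
  · exact Ideal.zero_mem _

/-- If `x i * f ∈ I_[k]` for all `(k, f) ∈ B`, then the vectors `(x i * f)` are generated over the
Rees algebra by finitely many of them. -/
theorem exists_finite_generators (hF : F.IsNoetherian) {r : ℕ} (x : Fin r → R) (B : Set (ℕ × R))
    (hB : ∀ b ∈ B, ∀ i, x i * b.2 ∈ F.ideal b.1) :
    ∃ G : Finset (ℕ × R), ↑G ⊆ B ∧ ∀ b ∈ B, ∃ c : ℕ × R → R,
      (∀ g, c g ∈ F.ideal (b.1 - g.1)) ∧ (∀ g, b.1 < g.1 → c g = 0) ∧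
      ∀ i, x i * b.2 = ∑ g ∈ G, c g * (x i * g.2) := by
  classical
  have : IsNoetherianRing F.reesAlgebra := hF
  let φ : ℕ × R → Fin r → F.reesAlgebra := fun g i =>
    if h : x i * g.2 ∈ F.ideal g.1 then ⟨_, monomial_mem_reesAlgebra h⟩ else 0
  have hφ : ∀ b ∈ B, ∀ i, (φ b i : R[X]) = Polynomial.monomial b.1 (x i * b.2) := fun b hb i => by
    simp [φ, hB b hb i]
  obtain ⟨t, ht, hspan⟩ := (Submodule.fg_span_iff_fg_span_finset_subset (φ '' B)).mp
    (_root_.IsNoetherian.noetherian (R := F.reesAlgebra) _)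
  obtain ⟨G, hG, rfl⟩ := Finset.subset_set_image_iff.mp ht
  refine ⟨G, hG, fun b hb => ?_⟩
  have hmem : φ b ∈ Submodule.span F.reesAlgebra (φ '' (G : Set (ℕ × R))) := by
    rw [← Finset.coe_image, ← hspan]
    exact Submodule.subset_span ⟨b, hb, rfl⟩
  obtain ⟨c, hc⟩ := (Submodule.mem_span_image_finset_iff_exists_fun' _).mp hmem
  -- Compare coefficients of `X^b.1`. If `b.1 < g.1`, the truncated difference is `0` and `F.ideal 0
  -- = ⊤`, so the vanishing of the coefficient has to be recorded separately.
  refine ⟨fun g => if g.1 ≤ b.1 then (c g : R[X]).coeff (b.1 - g.1) else 0, fun g => ?_,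
    fun g hg => if_neg hg.not_ge, fun i => ?_⟩
  · dsimp only
    split_ifs with h
    · exact (c g).2 _
    · exact Ideal.zero_mem _
  · have h := congrArg (fun v : Fin r → F.reesAlgebra => (v i : R[X]).coeff b.1) hc
    simp only [hφ b hb, Polynomial.coeff_monomial, if_true] at h
    rw [← h]
    simp only [Finset.sum_apply, Pi.smul_apply, smul_eq_mul, AddSubmonoidClass.coe_finsetSum,
      MulMemClass.coe_mul, Polynomial.finsetSum_coeff]
    refine Finset.sum_congr rfl fun g hg => ?_
    rw [hφ g (hG hg), ← Polynomial.C_mul_X_pow_eq_monomial, ← mul_assoc,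
      Polynomial.coeff_mul_X_pow', Polynomial.coeff_mul_C, ite_mul, zero_mul]

end GradedFiltration

/-- An ideal contains a homogeneous ideal as soon as it
contains its homogeneous elements. -/
theorem Ideal.IsHomogeneous.le_of_forall_mem {I J : Ideal R} (hI : I.IsHomogeneous 𝒜)
    (h : ∀ d, ∀ f ∈ 𝒜 d, f ∈ I → f ∈ J) : I ≤ J := fun f hf => by
  classical
  rw [← DirectSum.sum_support_decompose 𝒜 f]
  exact Ideal.sum_mem _ fun d _ => h d _ (SetLike.coe_mem _) (hI d hf)

variable {ι : Type*} [Fintype ι]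

theorem prod_pow_mem_gradedPart {s : ι → R} {δ : ι → ℕ} (hs : ∀ i, s i ∈ 𝒜 (δ i)) (a : ι → ℕ) :
    ∏ i, s i ^ a i ∈ 𝒜 (linForm δ a) := by
  have := SetLike.prod_pow_mem_graded 𝒜 (F := Finset.univ) δ s a fun i _ => hs i
  simpa [linForm, mul_comm] using this

/-- Homogeneous elements `s i` of positive weights `κ i` which generate a graded filtration:
`I_[k]` is generated by the monomials of weight `k` in the `s i`. -/
structure GradedFiltration.Generators (F : GradedFiltration 𝒜) (s : ι → R) (κ δ : ι → ℕ) :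
    Prop where
  weight_pos : ∀ i, 0 < κ i
  mem_ideal : ∀ i, s i ∈ F.ideal (κ i)
  mem_degree : ∀ i, s i ∈ 𝒜 (δ i)
  ideal_le : ∀ k, F.ideal k ≤ Ideal.span ((fun a => ∏ i, s i ^ a i) '' {a | linForm κ a = k})

theorem GradedFiltration.pow_mem_ideal {F : GradedFiltration 𝒜} {k : ℕ} {y : R}
    (hy : y ∈ F.ideal k) (n : ℕ) : y ^ n ∈ F.ideal (k * n) := by
  induction n with
  | zero => simp [F.ideal_zero]
  | succ n ih =>
    rw [pow_succ, mul_add, mul_one]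
    exact F.ideal_mul_le _ _ (Ideal.mul_mem_mul ih hy)

theorem GradedFiltration.prod_pow_mem_ideal {F : GradedFiltration 𝒜} {s : ι → R} {κ : ι → ℕ}
    (hs : ∀ i, s i ∈ F.ideal (κ i)) (a : ι → ℕ) : ∏ i, s i ^ a i ∈ F.ideal (linForm κ a) := by
  classical
  have : ∀ t : Finset ι, ∏ i ∈ t, s i ^ a i ∈ F.ideal (∑ i ∈ t, κ i * a i) := fun t => by
    induction t using Finset.induction with
    | empty => simp [F.ideal_zero]
    | insert i t hi ih =>
      rw [Finset.prod_insert hi, Finset.sum_insert hi]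
      exact F.ideal_mul_le _ _ (Ideal.mul_mem_mul (F.pow_mem_ideal (hs i) _) ih)
  exact this Finset.univ

/-- Homogeneous generators of the ideal of positive `X`-degree also generate the Rees algebra: their
weights are positive, so the coefficients come from earlier steps of the filtration. -/
theorem GradedFiltration.exists_generators {F : GradedFiltration 𝒜} (hF : F.IsNoetherian) :
    ∃ (G : Finset (ℕ × R)) (s : G → R) (κ δ : G → ℕ), F.Generators s κ δ := by
  classical
  obtain ⟨G, hGB, hG⟩ := exists_finite_generators hF (fun _ : Fin 1 => (1 : R))
    {b | 0 < b.1 ∧ b.2 ∈ F.ideal b.1 ∧ SetLike.IsHomogeneousElem 𝒜 b.2}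
    fun b hb _ => by simpa using hb.2.1
  have hdeg : ∀ g : G, ∃ d, g.1.2 ∈ 𝒜 d := fun g => (hGB g.2).2.2
  choose δ hδ using hdeg
  refine ⟨G, fun g => g.1.2, fun g => g.1.1, δ, fun g => (hGB g.2).1, fun g => (hGB g.2).2.1, hδ,
    fun k => ?_⟩
  induction k using Nat.strong_induction_on with
  | _ k ih =>
  rcases k.eq_zero_or_pos with rfl | hk
  · refine le_of_le_of_eq le_top ((Ideal.eq_top_iff_one _).mpr ?_).symm
    exact Ideal.subset_span ⟨0, by simp [linForm], by simp⟩
  refine (F.isHomogeneous k).le_of_forall_mem fun d f hfd hf => ?_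
  obtain ⟨c, hc, hc0, hsum⟩ := hG (k, f) ⟨hk, hf, d, hfd⟩
  have hsum := hsum 0
  simp only [one_mul] at hsum
  rw [hsum]
  refine Ideal.sum_mem _ fun g hg => ?_
  rcases lt_or_ge k g.1 with hlt | hle
  · rw [hc0 g hlt, zero_mul]
    exact Ideal.zero_mem _
  have hpos : 0 < g.1 := (hGB hg).1
  refine Submodule.span_induction (p := fun y _ => y * g.2 ∈ Ideal.span _) ?_ (by simp) ?_ ?_
    (ih _ (by omega) (hc g))
  · rintro _ ⟨a, ha, rfl⟩
    refine Ideal.subset_span ⟨a + Pi.single ⟨g, hg⟩ 1, ?_, ?_⟩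
    · rw [Set.mem_ofPred_eq, linForm_add, linForm_single, Set.mem_ofPred_eq.mp ha]
      dsimp only
      omega
    · simp only [Pi.add_apply, pow_add, Finset.prod_mul_distrib]
      congr 1
      rw [Finset.prod_eq_single ⟨g, hg⟩ (fun i _ hi => by simp [hi]) (by simp)]
      simp
  · intro x y _ _ hx hy
    rw [add_mul]
    exact Ideal.add_mem _ hx hy
  · intro r x _ hx
    rw [smul_eq_mul, mul_assoc]
    exact Ideal.mul_mem_left _ _ hx

end Rees

/-! ### Colon ideals and localization -/

section Contraction

variable {R : Type*} [CommRing R]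

/-- The elements of `R` which become elements of `I` in the localization at `p`. -/
def Ideal.localContraction (I p : Ideal R) [p.IsPrime] : Ideal R where
  carrier := {f | ∃ a ∉ p, a * f ∈ I}
  add_mem' := by
    rintro f g ⟨a, ha, haf⟩ ⟨b, hb, hbg⟩
    refine ⟨a * b, fun h => (Ideal.IsPrime.mem_or_mem ‹_› h).elim ha hb, ?_⟩
    have : a * b * (f + g) = b * (a * f) + a * (b * g) := by ring
    rw [this]
    exact I.add_mem (I.mul_mem_left _ haf) (I.mul_mem_left _ hbg)
  zero_mem' := ⟨1, (Ideal.ne_top_iff_one p).mp Ideal.IsPrime.ne_top', by simp⟩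
  smul_mem' := by
    rintro r f ⟨a, ha, haf⟩
    exact ⟨a, ha, by rw [smul_eq_mul, mul_left_comm]; exact I.mul_mem_left _ haf⟩

/-- The first condition is linear in `f` and feeds finite generation; the second is non-membership
in an ideal, hence passes to some summand of `f`. -/
theorem Ideal.colon_singleton_eq_iff {I p : Ideal R} [p.IsPrime] {f : R} :
    I.colon {f} = p ↔ (∀ y ∈ p, y * f ∈ I) ∧ f ∉ I.localContraction p := by
  constructor
  · rintro rfl
    refine ⟨fun y hy => Submodule.mem_colon_singleton.mp hy, ?_⟩
    rintro ⟨a, ha, haf⟩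
    exact ha (Submodule.mem_colon_singleton.mpr haf)
  · rintro ⟨h1, h2⟩
    refine le_antisymm (fun a ha => ?_) fun y hy => Submodule.mem_colon_singleton.mpr (h1 y hy)
    by_contra hap
    exact h2 ⟨a, hap, Submodule.mem_colon_singleton.mp ha⟩

theorem Ideal.localContraction_mono {I J : Ideal R} (h : I ≤ J) (p : Ideal R) [p.IsPrime] :
    I.localContraction p ≤ J.localContraction p :=
  fun _ ⟨a, ha, haf⟩ => ⟨a, ha, h haf⟩

end Contraction

/-! ### The v-number at a fixed prime -/

section Graded

variable {A R : Type*} [CommRing A] [CommRing R] [Algebra A R]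
variable {𝒜 : ℕ → Submodule A R}

theorem vNumberAt_le {I p : Ideal R} {f : R} {d : ℕ} (hf : f ∈ 𝒜 d) (hcolon : I.colon {f} = p) :
    vNumberAt 𝒜 I p ≤ d :=
  iInf₂_le d ⟨f, hf, hcolon⟩

variable [GradedAlgebra 𝒜]

theorem Ideal.IsHomogeneous.colon_singleton {I : Ideal R} (hI : I.IsHomogeneous 𝒜) {f : R} {d : ℕ}
    (hf : f ∈ 𝒜 d) : (I.colon {f}).IsHomogeneous 𝒜 := fun e y hy => by
  rw [Submodule.mem_colon_singleton, smul_eq_mul] at hy ⊢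
  rw [← DirectSum.coe_decompose_mul_add_of_right_mem 𝒜 hf]
  exact hI _ hy

theorem Ideal.IsHomogeneous.mul_decompose_eq_zero {p : Ideal R} (hp : p.IsHomogeneous 𝒜) {z : R}
    (hz : ∀ y ∈ p, y * z = 0) (d : ℕ) : ∀ y ∈ p, y * (DirectSum.decompose 𝒜 z d : R) = 0 := by
  classical
  intro y hy
  rw [← DirectSum.sum_support_decompose 𝒜 y, Finset.sum_mul]
  refine Finset.sum_eq_zero fun e _ => ?_
  rw [← DirectSum.coe_decompose_mul_add_of_left_mem 𝒜 (SetLike.coe_mem _), hz _ (hp e hy)]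
  simp

variable {F : GradedFiltration 𝒜}

/-- If `f ∈ 𝒜 d` is the sum of an element killed by `p` and of a combination of the `m g`, with
coefficients generated by monomials in the `s i`, and `f` is not in the ideal `T`, then some
homogeneous element killed by `p`, or some monomial multiple of some `m g` of degree at most `d`,
is not in `T`. -/
theorem exists_notMem_of_sub_sum_mul_eq_zero {ι γ : Type*} [Fintype ι] {p T : Ideal R}
    (hp : p.IsHomogeneous 𝒜) {s : ι → R} {δ : ι → ℕ} (hs : ∀ i, s i ∈ 𝒜 (δ i))
    (G : Finset γ) (m c : γ → R) (δ' : γ → ℕ) (hm : ∀ g ∈ G, m g ∈ 𝒜 (δ' g))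
    (E : γ → Set (ι → ℕ)) (hc : ∀ g ∈ G, c g ∈ Ideal.span ((fun a => ∏ i, s i ^ a i) '' E g))
    {f : R} {d : ℕ} (hf : f ∈ 𝒜 d) (hfT : f ∉ T)
    (hker : ∀ y ∈ p, y * (f - ∑ g ∈ G, c g * m g) = 0) :
    (∃ z ∈ 𝒜 d, (∀ y ∈ p, y * z = 0) ∧ z ∉ T) ∨
      ∃ g ∈ G, ∃ a ∈ E g, (∏ i, s i ^ a i) * m g ∉ T ∧ δ' g + linForm δ a ≤ d := by
  classical
  by_contra! hcon
  obtain ⟨hz, hmon⟩ := hcon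
  have hcomp : ∀ g ∈ G, (DirectSum.decompose 𝒜 (c g * m g) d : R) ∈ T := by
    intro g hg
    -- Allowing a multiplier `r` makes the claim stable under scalars in the span induction.
    suffices ∀ r, (DirectSum.decompose 𝒜 (r * c g * m g) d : R) ∈ T by simpa using this 1
    refine Submodule.span_induction
      (p := fun y _ => ∀ r, (DirectSum.decompose 𝒜 (r * y * m g) d : R) ∈ T) ?_ ?_ ?_ ?_ (hc g hg)
    · rintro _ ⟨a, ha, rfl⟩ r
      have hdeg : (∏ i, s i ^ a i) * m g ∈ 𝒜 (δ' g + linForm δ a) := by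
        rw [add_comm]
        exact SetLike.mul_mem_graded (prod_pow_mem_gradedPart hs a) (hm g hg)
      rw [mul_assoc, DirectSum.coe_decompose_mul_of_right_mem 𝒜 d hdeg]
      split_ifs with hle
      · refine T.mul_mem_left _ ?_
        by_contra hT
        exact absurd (hmon g hg a ha hT) hle.not_gt
      · exact T.zero_mem
    · intro r
      simp
    · intro x y _ _ hx hy r
      rw [mul_add, add_mul, DirectSum.decompose_add]
      exact T.add_mem (hx r) (hy r)
    · intro t x _ hx r
      rw [smul_eq_mul, ← mul_assoc r]
      exact hx (r * t)
  refine hfT ?_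
  have hsplit : f = (DirectSum.decompose 𝒜 (f - ∑ g ∈ G, c g * m g) d : R) +
      ∑ g ∈ G, (DirectSum.decompose 𝒜 (c g * m g) d : R) := by
    conv_lhs => rw [← DirectSum.decompose_of_mem_same 𝒜 hf]
    rw [DirectSum.decompose_sub, DirectSum.decompose_sum]
    simp
  rw [hsplit]
  exact T.add_mem (hz _ (SetLike.coe_mem _) (hp.mul_decompose_eq_zero hker d)) (T.sum_mem hcomp)

/-- The map `f ↦ (x i * f)` has the annihilator of `p` as kernel, so generation of the vectors lifts
only modulo it. -/
theorem GradedFiltration.exists_colon_generators [IsNoetherianRing R] (hF : F.IsNoetherian)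
    (p : Ideal R) :
    ∃ G : Finset (ℕ × R), (∀ g ∈ G, SetLike.IsHomogeneousElem 𝒜 g.2 ∧
        ∀ y ∈ p, y * g.2 ∈ F.ideal g.1) ∧
      ∀ k, ∀ f, SetLike.IsHomogeneousElem 𝒜 f → (∀ y ∈ p, y * f ∈ F.ideal k) →
        ∃ c : ℕ × R → R, (∀ g, c g ∈ F.ideal (k - g.1)) ∧ (∀ g, k < g.1 → c g = 0) ∧
          ∀ y ∈ p, y * (f - ∑ g ∈ G, c g * g.2) = 0 := by
  obtain ⟨r, x, hx⟩ := Submodule.fg_iff_exists_fin_generating_family.mp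
    (_root_.IsNoetherian.noetherian p)
  have hxp : ∀ i, x i ∈ p := fun i => hx ▸ Submodule.subset_span ⟨i, rfl⟩
  obtain ⟨G, hGB, hG⟩ := exists_finite_generators hF x
    {b | SetLike.IsHomogeneousElem 𝒜 b.2 ∧ ∀ y ∈ p, y * b.2 ∈ F.ideal b.1}
    fun b hb i => hb.2 _ (hxp i)
  refine ⟨G, fun g hg => hGB hg, fun k f hf hpf => ?_⟩
  obtain ⟨c, hc, hc0, hsum⟩ := hG (k, f) ⟨hf, hpf⟩
  refine ⟨c, hc, hc0, fun y hy => ?_⟩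
  rw [← hx] at hy
  refine Submodule.span_induction
    (p := fun y _ => y * (f - ∑ g ∈ G, c g * g.2) = 0) ?_ (by simp) ?_ ?_ hy
  · rintro _ ⟨i, rfl⟩
    rw [mul_sub, hsum i, Finset.mul_sum, ← Finset.sum_sub_distrib]
    exact Finset.sum_eq_zero fun g _ => by ring
  · intro a b _ _ ha hb
    rw [add_mul, ha, hb, add_zero]
  · intro a b _ hb
    rw [smul_eq_mul, mul_assoc, hb, mul_zero]

/-- The `v`-numbers of the ideals of a Noetherian graded filtration at a fixed prime ideal. -/
theorem GradedFiltration.quasiAffine_vNumberAt [IsNoetherianRing R] (hF : F.IsNoetherian)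
    (p : Ideal R) [p.IsPrime] : QuasiAffine fun k => vNumberAt 𝒜 (F.ideal k) p := by
  classical
  by_cases hp : p.IsHomogeneous 𝒜
  swap
  · refine .of_eventually_const (n := ⊤) (.of_forall fun k => ?_)
    simp only [vNumberAt, iInf_eq_top]
    rintro d ⟨f, hf, rfl⟩
    exact absurd ((F.isHomogeneous k).colon_singleton hf) hp
  obtain ⟨S, s, κ, δ, hs⟩ := F.exists_generators hF
  obtain ⟨G, hGp, hG⟩ := F.exists_colon_generators hF p
  choose! δ' hδ' using fun g hg => (hGp g hg).1
  let T := fun k => (F.ideal k).localContraction p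
  have hT : Antitone T := fun _ _ h => Ideal.localContraction_mono (F.antitone_ideal h) p
  let ζ : ℕ → ℕ∞ := fun k => minWeight {d | ∃ z ∈ 𝒜 d, (∀ y ∈ p, y * z = 0) ∧ z ∉ T k} id
  -- As `k` grows, `T k` shrinks and more annihilator elements qualify.
  have hζ : QuasiAffine ζ := .of_antitone fun k l hkl => by
    refine le_iInf₂ fun d ⟨z, hzd, hzp, hzT⟩ => minWeight_le (w := id) ?_
    exact ⟨z, hzd, hzp, fun h => hzT (hT hkl h)⟩
  let D : ℕ × R → Set (S → ℕ) := fun g =>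
    {a | (∏ i, s i ^ a i) * g.2 ∉ T (g.1 + linForm κ a)}
  -- Multiplying by `s^t` raises the filtration index by the weight of `t`, so membership in `T`
  -- persists upwards.
  have hD : ∀ g ∈ G, IsLowerSet (D g) := by
    intro g _ b a hab hb ha
    obtain ⟨t, rfl⟩ := exists_add_of_le hab
    refine hb ?_
    obtain ⟨u, hu, hua⟩ := ha
    refine ⟨u, hu, ?_⟩
    have hprod : u * ((∏ i, s i ^ (a + t) i) * g.2) =
        (u * ((∏ i, s i ^ a i) * g.2)) * ∏ i, s i ^ t i := by
      simp only [Pi.add_apply, pow_add, Finset.prod_mul_distrib]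
      ring
    rw [hprod, linForm_add, ← add_assoc]
    exact F.ideal_mul_le _ _ (Ideal.mul_mem_mul hua (prod_pow_mem_ideal hs.mem_ideal t))
  have key := hζ.min (QuasiAffine.iInf_finset G fun g hg =>
    (hD g hg).quasiAffine_minWeight hs.weight_pos δ g.1 (δ' g))
  convert key using 2 with k
  refine le_antisymm (le_inf ?_ ?_) (le_iInf₂ ?_)
  · refine le_iInf₂ fun d ⟨z, hzd, hzp, hzT⟩ => vNumberAt_le hzd ?_
    refine Ideal.colon_singleton_eq_iff.mpr ⟨fun y hy => ?_, hzT⟩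
    rw [hzp y hy]
    exact Ideal.zero_mem _
  · refine le_iInf₂ fun g hg => le_iInf₂ fun a ⟨haD, hak⟩ => ?_
    refine vNumberAt_le (f := (∏ i, s i ^ a i) * g.2) ?_
      (Ideal.colon_singleton_eq_iff.mpr ⟨fun y hy => ?_, hak ▸ haD⟩)
    · dsimp only
      rw [add_comm]
      exact SetLike.mul_mem_graded (prod_pow_mem_gradedPart hs.mem_degree a) (hδ' g hg)
    · rw [mul_left_comm, mul_comm, ← hak]
      exact F.ideal_mul_le _ _ (Ideal.mul_mem_mul ((hGp g hg).2 y hy)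
        (prod_pow_mem_ideal hs.mem_ideal a))
  · rintro d ⟨f, hfd, hcolon⟩
    obtain ⟨hpf, hfT⟩ := Ideal.colon_singleton_eq_iff.mp hcolon
    obtain ⟨c, hc, hc0, hker⟩ := hG k f ⟨d, hfd⟩ hpf
    have hspan : ∀ g ∈ G, c g ∈ Ideal.span
        ((fun a => ∏ i, s i ^ a i) '' {a | g.1 + linForm κ a = k}) := by
      intro g _
      rcases lt_or_ge k g.1 with hlt | hle
      · rw [hc0 g hlt]
        exact Ideal.zero_mem _
      · refine Ideal.span_mono (Set.image_mono fun a ha => ?_) (hs.ideal_le _ (hc g))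
        rw [Set.mem_ofPred_eq] at ha ⊢
        omega
    rcases exists_notMem_of_sub_sum_mul_eq_zero hp hs.mem_degree G Prod.snd c δ' hδ' _ hspan hfd
      hfT hker with hz | ⟨g, hg, a, ha, haT, hle⟩
    · exact inf_le_left.trans (minWeight_le (w := id) hz)
    · refine inf_le_right.trans ((iInf₂_le g hg).trans ?_)
      have haD : a ∈ D g ∧ g.1 + linForm κ a = k := ⟨by
        rw [Set.mem_ofPred_eq] at ha
        rwa [Set.mem_ofPred_eq, ha], ha⟩
      exact (minWeight_le (s := {a | a ∈ D g ∧ g.1 + linForm κ a = k}) haD).trans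
        (by exact_mod_cast hle)

end Graded

/-! ### Finiteness of the set of primes and of the v-number -/

section AssociatedPrimes

variable {A R : Type*} [CommRing A] [CommRing R] [Algebra A R]
variable {𝒜 : ℕ → Submodule A R} [GradedAlgebra 𝒜] {F : GradedFiltration 𝒜}

namespace GradedFiltration

/-- Only zero is killed by `I_[1]` in `I_[k]`, for large `k`. -/
theorem eventually_eq_zero_of_mul_eq_zero (hF : F.IsNoetherian) :
    ∀ᶠ k in atTop, ∀ z ∈ F.ideal k, (∀ y ∈ F.ideal 1, y * z = 0) → z = 0 := by
  obtain ⟨G, hGB, hG⟩ := exists_finite_generators hF (fun _ : Fin 1 => (1 : R))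
    {b | b.2 ∈ F.ideal b.1 ∧ ∀ y ∈ F.ideal 1, y * b.2 = 0} fun b hb _ => by simpa using hb.1
  refine eventually_atTop.mpr ⟨G.sup Prod.fst + 1, fun k hk z hz hz0 => ?_⟩
  obtain ⟨c, hc, -, hsum⟩ := hG (k, z) ⟨hz, hz0⟩
  have hsum := hsum 0
  simp only [one_mul] at hsum
  rw [hsum]
  -- Now `k - g.1 ≥ 1`, so each coefficient lies in `I_[1]`, which kills the generators.
  refine Finset.sum_eq_zero fun g hg => (hGB hg).2 _ (F.antitone_ideal ?_ (hc g))
  have : g.1 ≤ G.sup Prod.fst := Finset.le_sup (f := Prod.fst) hg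
  dsimp only
  omega

/-- The quotient of `S ^ r` by the vector `x`, where `S` is the Rees algebra. -/
abbrev reesQuotient (F : GradedFiltration 𝒜) {r : ℕ} (x : Fin r → R) : Type _ :=
  (Fin r → F.reesAlgebra) ⧸
    Submodule.span F.reesAlgebra {fun i => algebraMap R F.reesAlgebra (x i)}

theorem exists_comap_colon_eq {r : ℕ} (x : Fin r → R) {k : ℕ} {f : R}
    (hf : ∀ i, x i * f ∈ F.ideal k) : ∃ w : F.reesQuotient x, ∀ a : R,
      a ∈ ((⊥ : Submodule F.reesAlgebra (F.reesQuotient x)).colon {w}).comap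
        (algebraMap R F.reesAlgebra) ↔ ∃ g ∈ F.ideal k, ∀ i, x i * (a * f - g) = 0 := by
  refine ⟨Submodule.Quotient.mk fun i => ⟨_, monomial_mem_reesAlgebra (hf i)⟩, fun a => ?_⟩
  rw [Ideal.mem_comap, Submodule.mem_colon_singleton, ← Submodule.Quotient.mk_smul,
    Submodule.mem_bot, Submodule.Quotient.mk_eq_zero, Submodule.mem_span_singleton]
  constructor
  · rintro ⟨s, hs⟩
    refine ⟨(s : R[X]).coeff k, s.2 k, fun i => ?_⟩
    have h := congrArg (fun v : Fin r → F.reesAlgebra => (v i : R[X]).coeff k) hs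
    simp at h
    linear_combination -h
  · rintro ⟨g, hg, hag⟩
    refine ⟨⟨_, monomial_mem_reesAlgebra hg⟩, funext fun i => Subtype.ext ?_⟩
    have : g * x i = a * (x i * f) := by linear_combination -hag i
    simp [Polynomial.monomial_mul_C, Polynomial.C_mul_monomial, this]

/-- The prime ideals of the form `(I_[k] : f)` for large `k` form a finite set. -/
theorem exists_finite_primes [IsNoetherianRing R] (hF : F.IsNoetherian) :
    ∃ P : Set (Ideal R), P.Finite ∧ (∀ p ∈ P, p.IsPrime) ∧
      ∀ᶠ k in atTop, ∀ f, ((F.ideal k).colon {f}).IsPrime → (F.ideal k).colon {f} ∈ P := by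
  have : IsNoetherianRing F.reesAlgebra := hF
  obtain ⟨r, x, hx⟩ := Submodule.fg_iff_exists_fin_generating_family.mp
    (_root_.IsNoetherian.noetherian (F.ideal 1))
  have hxJ : ∀ i, x i ∈ F.ideal 1 := fun i => hx ▸ Submodule.subset_span ⟨i, rfl⟩
  refine ⟨associatedPrimes R R ∪ Ideal.comap (algebraMap R F.reesAlgebra) ''
    associatedPrimes F.reesAlgebra (F.reesQuotient x),
    (associatedPrimes.finite R R).union ((associatedPrimes.finite _ _).image _), ?_, ?_⟩
  · rintro p (hp | ⟨q, hq, rfl⟩)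
    · exact hp.isPrime
    · have := hq.isPrime
      infer_instance
  filter_upwards [F.eventually_eq_zero_of_mul_eq_zero hF] with k hk f hprime
  set p := (F.ideal k).colon {f} with hp
  have hmem : ∀ {a}, a ∈ p ↔ a * f ∈ F.ideal k := Submodule.mem_colon_singleton
  have hJp : F.ideal 1 ≤ p := fun y hy => by
    refine hprime.mem_of_pow_mem k (hmem.mpr (Ideal.mul_mem_right _ _ ?_))
    simpa using F.pow_mem_ideal hy k
  -- In the first case `z = a * f - g` is killed by `I_[1]`. For `b ∈ p` the product `b * z` also
  -- lies in `I_[k]`, so it vanishes for large `k`; hence `p` is the annihilator of `z`.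
  by_cases hcase : ∃ a ∉ p, ∃ g ∈ F.ideal k, ∀ i, x i * (a * f - g) = 0
  · obtain ⟨a, ha, g, hg, hag⟩ := hcase
    have hz : ∀ y ∈ F.ideal 1, y * (a * f - g) = 0 := fun y hy => by
      rw [← hx] at hy
      refine Submodule.span_induction (p := fun y _ => y * (a * f - g) = 0) ?_ (by simp) ?_ ?_ hy
      · rintro _ ⟨i, rfl⟩
        exact hag i
      · intro b c _ _ hb hc
        rw [add_mul, hb, hc, add_zero]
      · intro b c _ hc
        rw [smul_eq_mul, mul_assoc, hc, mul_zero]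
    refine Or.inl (isAssociatedPrime_iff.mpr ⟨hprime, a * f - g, Ideal.ext fun b => ?_⟩)
    rw [hmem, Submodule.mem_colon_singleton, Submodule.mem_bot, smul_eq_mul]
    constructor
    · intro hb
      refine hk _ ?_ fun y hy => by rw [mul_left_comm, hz y hy, mul_zero]
      rw [mul_sub, mul_left_comm]
      exact sub_mem (Ideal.mul_mem_left _ _ hb) (Ideal.mul_mem_left _ _ hg)
    · intro hb
      have hba : b * a ∈ p := hmem.mpr <| by
        have : b * a * f = b * g := by linear_combination hb
        rw [this]
        exact Ideal.mul_mem_left _ _ hg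
      exact hmem.mp ((hprime.mem_or_mem hba).resolve_right ha)
  · push Not at hcase
    obtain ⟨w, hw⟩ := exists_comap_colon_eq (F := F) x fun i => hmem.mp (hJp (hxJ i))
    have hcomap : p = ((⊥ : Submodule F.reesAlgebra (F.reesQuotient x)).colon {w}).comap
        (algebraMap R F.reesAlgebra) := Ideal.ext fun a => by
      rw [hw]
      constructor
      · exact fun ha => ⟨a * f, hmem.mp ha, by simp⟩
      · rintro ⟨g, hg, hag⟩
        by_contra ha
        obtain ⟨i, hi⟩ := hcase a ha g hg
        exact hi (hag i)
    -- Being prime, `p` is contracted from a minimal prime over the annihilator of `w`, and such a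
    -- prime is associated.
    obtain ⟨q, hq, hqp⟩ := Ideal.exists_minimalPrimes_comap_eq (algebraMap R F.reesAlgebra) p (by
      rw [← hcomap, Ideal.minimalPrimes_eq_subsingleton_self]
      exact Set.mem_singleton p)
    obtain ⟨w', hw'⟩ := Submodule.exists_eq_colon_of_mem_minimalPrimes hq
    exact Or.inr ⟨q, isAssociatedPrime_iff.mpr ⟨hq.isPrime, w', hw'⟩, hqp⟩

end GradedFiltration

theorem mem_associatedPrimes_of_colon_eq {R : Type*} [CommRing R] {I p : Ideal R} [hp : p.IsPrime]
    {f : R} (h : I.colon {f} = p) : p ∈ associatedPrimes R (R ⧸ I) := by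
  refine ⟨hp, Ideal.Quotient.mk I f, ?_⟩
  have : (⊥ : Submodule R (R ⧸ I)).colon {Ideal.Quotient.mk I f} = p := by
    rw [← h]
    ext a
    rw [Submodule.mem_colon_singleton, Submodule.mem_colon_singleton, Submodule.mem_bot,
      smul_eq_mul, ← Ideal.Quotient.eq_zero_iff_mem, map_mul]
    rfl
  rw [this, hp.radical]

/-- A proper homogeneous ideal of a Noetherian graded ring has an associated prime which is the
annihilator of the class of a homogeneous element. -/
theorem exists_isPrime_colon_singleton [IsNoetherianRing R] {I : Ideal R} (hI : I.IsHomogeneous 𝒜)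
    (hne : I ≠ ⊤) : ∃ d, ∃ f ∈ 𝒜 d, (I.colon {f}).IsPrime := by
  -- A maximal colon by homogeneous elements outside `I` is prime, since primality of a homogeneous
  -- ideal can be tested on homogeneous elements.
  obtain ⟨_, ⟨f, ⟨d, hfd⟩, hfI, rfl⟩, hmax⟩ := set_has_maximal_iff_noetherian.mpr
    (inferInstanceAs (IsNoetherianRing R))
    {J : Ideal R | ∃ f, SetLike.IsHomogeneousElem 𝒜 f ∧ f ∉ I ∧ J = I.colon {f}}
    ⟨_, 1, SetLike.isHomogeneousElem_one 𝒜, (Ideal.ne_top_iff_one I).mp hne, rfl⟩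
  refine ⟨d, f, hfd, (hI.colon_singleton hfd).isPrime_of_homogeneous_mem_or_mem ?_ ?_⟩
  · rw [Ideal.ne_top_iff_one, Submodule.mem_colon_singleton, one_smul]
    exact hfI
  · intro a b _ hb hab
    by_contra! h
    obtain ⟨ha, hb'⟩ := h
    rw [Submodule.mem_colon_singleton, smul_eq_mul] at ha hb' hab
    refine hmax _ ⟨b * f, hb.mul ⟨d, hfd⟩, hb', rfl⟩ (lt_of_le_of_ne (fun c hc => ?_) fun h => ?_)
    · rw [Submodule.mem_colon_singleton, smul_eq_mul] at hc ⊢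
      rw [mul_left_comm]
      exact I.mul_mem_left _ hc
    · refine ha (Submodule.mem_colon_singleton.mp (h ▸ Submodule.mem_colon_singleton.mpr ?_))
      rwa [smul_eq_mul, ← mul_assoc]

theorem vNumber_ne_top [IsNoetherianRing R] {I : Ideal R} (hI : I.IsHomogeneous 𝒜)
    (hne : I ≠ ⊤) : vNumber 𝒜 I ≠ ⊤ := by
  obtain ⟨d, f, hf, hp⟩ := exists_isPrime_colon_singleton hI hne
  exact ((iInf₂_le _ (mem_associatedPrimes_of_colon_eq rfl)).trans_lt
    ((vNumberAt_le hf rfl).trans_lt (ENat.natCast_lt_top d))).ne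

/-- For large `k` the minimum may be taken over the fixed finite set `P`: members that are not
associated primes contribute `⊤`. -/
theorem GradedFiltration.quasiAffine_vNumber [IsNoetherianRing R] (hF : F.IsNoetherian) :
    QuasiAffine fun k => vNumber 𝒜 (F.ideal k) := by
  obtain ⟨P, hfin, hprime, hP⟩ := F.exists_finite_primes hF
  obtain ⟨c, hc, h⟩ := QuasiAffine.iInf_finset hfin.toFinset
    (f := fun p k => vNumberAt 𝒜 (F.ideal k) p) fun p hp => by
      have := hprime p (hfin.mem_toFinset.mp hp)
      exact F.quasiAffine_vNumberAt hF p
  refine ⟨c, hc, fun i => (h i).congr ?_⟩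
  have htend : Tendsto (fun j => i + c * j) atTop atTop :=
        tendsto_atTop_mono (fun j => le_add_left (Nat.le_mul_of_pos_left j hc)) tendsto_id
  filter_upwards [htend.eventually hP] with j hj
  refine le_antisymm (le_iInf₂ fun p hp => le_iInf₂ fun d => ?_)
    (le_iInf₂ fun p hp => le_iInf₂ fun d => ?_)
  · rintro ⟨f, hf, hcolon⟩
    have := hprime p (hfin.mem_toFinset.mp hp)
    exact (iInf₂_le p (mem_associatedPrimes_of_colon_eq hcolon)).trans (vNumberAt_le hf hcolon)
  · rintro ⟨f, hf, rfl⟩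
    exact (iInf₂_le _ (hfin.mem_toFinset.mpr (hj f hp.isPrime))).trans (vNumberAt_le hf rfl)

end AssociatedPrimes

theorem theorem1p2 {A R : Type*} [CommRing A] [IsNoetherianRing A]
    [CommRing R] [Algebra A R] [Algebra.FiniteType A R]
    (𝒜 : ℕ → Submodule A R) [GradedAlgebra 𝒜]
    (m : Ideal R) (hm : IsMaximalGradedIdeal 𝒜 m)
    (hfield : IsField (R ⧸ m)) (hinf : Infinite (R ⧸ m))
    (F : GradedFiltration 𝒜) (hF : F.IsNoetherian) (hproper : ∃ k, F.ideal k ≠ ⊤) :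
    IsEventuallyQuasiLinear (fun k => vNumber 𝒜 (F.ideal k)) := by
  have : IsNoetherianRing R := Algebra.FiniteType.isNoetherianRing A R
  obtain ⟨k₀, hk₀⟩ := hproper
  refine (F.quasiAffine_vNumber hF).isEventuallyQuasiLinear
    (eventually_atTop.mpr ⟨k₀, fun k hk => vNumber_ne_top (F.isHomogeneous k) fun h => hk₀ ?_⟩)
  exact top_le_iff.mp (h ▸ F.antitone_ideal hk)
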